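/- Let $D$ be an infinite division ring and let $n\ge 1$ be an integer. Let $\mathrm{GL}_n(D)$ denote the group of units of the ring $M_n(D)$ of $n\times n$ matrices over $D$. Then $\mathrm{GL}_n(D)$ is not polycyclic-by-finite; that is, $\mathrm{GL}_n(D)$ has no normal subgroup $H$ of finite index that is polycyclic. Here a group $H$ is polycyclic if it has a finite series $1=H_0\trianglelefteq H_1\trianglelefteq\cdots\trianglelefteq H_k=H$ in which each $H_i$ is normal in $H_{i+1}$ and every factor $H_{i+1}/H_i$ is cyclic. -/

import Mathlib

/-- A group `G` is polycyclic if it has a finite subnormal series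
`1 = H 0 ≤ H 1 ≤ ⋯ ≤ H k = G`, each term normal in the next one, with cyclic factors
`H (i + 1) / H i`. -/
def IsPolycyclic (G : Type*) [Group G] : Prop :=
  ∃ (k : ℕ) (H : ℕ → Subgroup G), H 0 = ⊥ ∧ H k = ⊤ ∧
    ∀ i < k, H i ≤ H (i + 1) ∧
      ∃ _ : ((H i).subgroupOf (H (i + 1))).Normal,
        IsCyclic (H (i + 1) ⧸ (H i).subgroupOf (H (i + 1)))

/-- A group `G` is polycyclic-by-finite if it has a polycyclic normal subgroup `H` such that
`G / H` is finite. -/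
def IsPolycyclicByFinite (G : Type*) [Group G] : Prop :=
  ∃ H : Subgroup G, H.Normal ∧ H.FiniteIndex ∧ IsPolycyclic H

universe u

/-! Two properties pass from cyclic and finite groups to polycyclic-by-finite ones through
extensions, and then to subgroups: every subgroup is finitely generated, and every torsion subgroup
is finite. Scalar matrices embed `Dˣ` in the general linear group, so `Dˣ` has both. Each unit lies
in a subfield of `D` whose unit group is finitely generated; such a field is finite
(`Field.finite_of_fg_units`), so `Dˣ` is torsion, hence finite, and `D` is finite. -/

/-- Every subgroup of `G` is finitely generated. -/
def IsNoetherianGroup (G : Type*) [Group G] : Prop :=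
  ∀ K : Subgroup G, K.FG

theorem Subgroup.FG.of_map_of_inf_ker {G Q : Type*} [Group G] [Group Q] (f : G →* Q)
    {K : Subgroup G} (hmap : (K.map f).FG) (hker : (K ⊓ f.ker).FG) : K.FG := by
  obtain ⟨S, hS, hfin⟩ := (Subgroup.fg_iff _).1 hmap
  have hSK : S ⊆ f '' (K : Set G) := by
    rw [← Subgroup.coe_map, ← hS]
    exact Subgroup.subset_closure
  obtain ⟨T, hTK, hT, hS⟩ := (Set.exists_subset_image_finite_and
    (p := fun S ↦ Subgroup.closure S = K.map f)).1 ⟨S, hSK, hfin, hS⟩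
  have hle : Subgroup.closure T ≤ K := (Subgroup.closure_le K).2 hTK
  have hTfg : (Subgroup.closure T).FG := (Subgroup.fg_iff _).2 ⟨T, rfl, hT⟩
  -- `T` lifts generators of the image, so each element of `K` is an element of the closure of `T`
  -- times one of the kernel.
  have hK : Subgroup.closure T ⊔ (K ⊓ f.ker) = K := by
    refine le_antisymm (sup_le hle inf_le_left) fun x hx ↦ ?_
    have hfx : f x ∈ (Subgroup.closure T).map f := by
      rw [MonoidHom.map_closure, hS]
      exact Subgroup.mem_map_of_mem f hx
    obtain ⟨y, hy, hyx⟩ := hfx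
    rw [← mul_inv_cancel_left y x]
    refine Subgroup.mul_mem_sup hy ⟨K.mul_mem (K.inv_mem (hle hy)) hx, ?_⟩
    simp [hyx]
  exact hK ▸ hTfg.sup hker

namespace IsNoetherianGroup

variable {G G' : Type*} [Group G] [Group G']

theorem of_injective (h : IsNoetherianGroup G') (f : G →* G') (hf : Function.Injective f) :
    IsNoetherianGroup G := fun K ↦
  Subgroup.FG.of_map_of_inf_ker f (h _) (by
    rw [(MonoidHom.ker_eq_bot_iff f).2 hf, inf_bot_eq]
    exact Subgroup.FG.bot)

theorem of_quotient (N : Subgroup G) [N.Normal] (hN : IsNoetherianGroup N)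
    (hQ : IsNoetherianGroup (G ⧸ N)) : IsNoetherianGroup G := fun K ↦
  Subgroup.FG.of_map_of_inf_ker (QuotientGroup.mk' N) (hQ _) (by
    rw [QuotientGroup.ker_mk', ← Subgroup.subgroupOf_map_subtype]
    rw [← Group.fg_iff_subgroup_fg]
    have := (Group.fg_iff_subgroup_fg _).2 (hN (K.subgroupOf N))
    exact Group.fg_of_surjective (MonoidHom.subgroupMap_surjective N.subtype (K.subgroupOf N)))

theorem of_finite [Finite G] : IsNoetherianGroup G := fun K ↦
  (Group.fg_iff_subgroup_fg K).1 inferInstance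

theorem of_isCyclic [IsCyclic G] : IsNoetherianGroup G := fun K ↦ by
  obtain ⟨g, hg⟩ := (Subgroup.isCyclic_iff_exists_zpowers_eq_top K).1 inferInstance
  exact (Subgroup.fg_iff K).2
    ⟨{g}, by rw [← hg, Subgroup.zpowers_eq_closure], Set.finite_singleton g⟩

end IsNoetherianGroup

/-- Every torsion subgroup of `G` is finite. -/
def HasFiniteTorsionSubgroups (G : Type*) [Group G] : Prop :=
  ∀ K : Subgroup G, (∀ g ∈ K, IsOfFinOrder g) → Finite K

namespace HasFiniteTorsionSubgroups

variable {G G' : Type*} [Group G] [Group G']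

theorem of_injective (h : HasFiniteTorsionSubgroups G') (f : G →* G')
    (hf : Function.Injective f) : HasFiniteTorsionSubgroups G := fun K hK ↦ by
  have : Finite (K.map f) := h _ (by
    rintro _ ⟨g, hg, rfl⟩
    exact f.isOfFinOrder (hK g hg))
  exact .of_injective _ (K.equivMapOfInjective f hf).injective

/-- A torsion subgroup `K` is an extension of its image in `G ⧸ N` by `K ⊓ N`; both are torsion,
hence finite. -/
theorem of_quotient (N : Subgroup G) [N.Normal] (hN : HasFiniteTorsionSubgroups N)
    (hQ : HasFiniteTorsionSubgroups (G ⧸ N)) : HasFiniteTorsionSubgroups G := fun K hK ↦ by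
  let f : K →* G ⧸ N := (QuotientGroup.mk' N).comp K.subtype
  have hrange : Finite f.range := hQ _ (by
    rintro _ ⟨g, rfl⟩
    exact (QuotientGroup.mk' N).isOfFinOrder (hK g g.2))
  have hint : Finite (K.subgroupOf N) := hN _ fun g hg ↦ Submonoid.isOfFinOrder_coe.1 (hK g hg)
  have hker : Finite f.ker := by
    have hmem (x : f.ker) : ((x : K) : G) ∈ N :=
      (QuotientGroup.eq_one_iff _).1 (MonoidHom.mem_ker.1 x.2)
    exact .of_injective (fun x : f.ker ↦ (⟨⟨(x : K), hmem x⟩, (x : K).2⟩ : K.subgroupOf N))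
      fun x y hxy ↦ Subtype.ext (Subtype.ext
        (congrArg (fun z : K.subgroupOf N ↦ ((z : N) : G)) hxy))
  have : Finite (K ⧸ f.ker) :=
    .of_injective _ (QuotientGroup.quotientKerEquivRange f).injective
  exact .of_subgroup_quotient f.ker

theorem of_finite [Finite G] : HasFiniteTorsionSubgroups G := fun _ _ ↦ inferInstance

theorem of_isCyclic [IsCyclic G] : HasFiniteTorsionSubgroups G := fun K hK ↦ by
  obtain ⟨g, rfl⟩ := (Subgroup.isCyclic_iff_exists_zpowers_eq_top K).1 inferInstance
  exact (hK g (Subgroup.mem_zpowers g)).finite_zpowers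

end HasFiniteTorsionSubgroups

/-- A property of groups that holds for cyclic groups and is stable under isomorphisms and
extensions holds for polycyclic groups. -/
theorem IsPolycyclic.induction {P : ∀ (G : Type u) [Group G], Prop}
    (equiv : ∀ (G G' : Type u) [Group G] [Group G'], (G ≃* G') → P G' → P G)
    (cyclic : ∀ (G : Type u) [Group G] [IsCyclic G], P G)
    (extension : ∀ (G : Type u) [Group G] (N : Subgroup G) [N.Normal], P N → P (G ⧸ N) → P G)
    {G : Type u} [Group G] (h : IsPolycyclic G) : P G := by
  obtain ⟨k, H, h0, hk, hH⟩ := h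
  have key : ∀ i ≤ k, P (H i) := by
    intro i
    induction i with
    | zero =>
      intro _
      rw [h0]
      exact cyclic _
    | succ i ih =>
      intro hi
      obtain ⟨hle, hn, hc⟩ := hH i hi
      exact extension _ ((H i).subgroupOf (H (i + 1)))
        (equiv _ _ (Subgroup.subgroupOfEquivOfLe hle) (ih (by omega))) (cyclic _)
  have htop := key k le_rfl
  rw [hk] at htop
  exact equiv _ _ Subgroup.topEquiv.symm htop

namespace IsPolycyclicByFinite

variable {G : Type*} [Group G]

theorem isNoetherianGroup (h : IsPolycyclicByFinite G) : IsNoetherianGroup G := by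
  obtain ⟨H, _, _, hH⟩ := h
  exact .of_quotient H
    (hH.induction (fun _ _ _ _ e h ↦ h.of_injective e.toMonoidHom e.injective)
      (fun _ _ _ ↦ .of_isCyclic) fun _ _ N _ ↦ .of_quotient N) .of_finite

theorem hasFiniteTorsionSubgroups (h : IsPolycyclicByFinite G) :
    HasFiniteTorsionSubgroups G := by
  obtain ⟨H, _, _, hH⟩ := h
  exact .of_quotient H
    (hH.induction (fun _ _ _ _ e h ↦ h.of_injective e.toMonoidHom e.injective)
      (fun _ _ _ ↦ .of_isCyclic) fun _ _ N _ ↦ .of_quotient N) .of_finite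

end IsPolycyclicByFinite

/-- Only the zero ideal needs an argument: a nonzero integer in every maximal ideal would be
divisible by arbitrarily large primes. The instance makes Zariski's lemma available over `ℤ`. -/
instance Int.isJacobsonRing : IsJacobsonRing ℤ := by
  refine isJacobsonRing_iff_prime_eq.2 fun P hP ↦ ?_
  by_cases hbot : P = ⊥
  · subst hbot
    refine le_bot_iff.1 fun x hx ↦ ?_
    by_contra hx0
    obtain ⟨p, hxp, hp⟩ := Nat.exists_infinite_primes (x.natAbs + 1)
    have hpZ : Prime (p : ℤ) := Nat.prime_iff_prime_int.1 hp
    have hmax : (Ideal.span {(p : ℤ)}).IsMaximal :=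
      PrincipalIdealRing.isMaximal_of_irreducible hpZ.irreducible
    have hdvd := Ideal.mem_span_singleton.1 (Ideal.mem_sInf.1 hx ⟨bot_le, hmax⟩)
    have := Nat.le_of_dvd (Int.natAbs_pos.2 hx0) (Int.natCast_dvd.1 hdvd)
    omega
  · have := hP.isMaximal hbot
    exact Ideal.jacobson_eq_self_of_isMaximal

/-- A field whose multiplicative group is finitely generated is finite. -/
theorem Field.finite_of_fg_units (K : Type*) [Field K] [Group.FG Kˣ] : Finite K := by
  obtain ⟨S, hS, hfin⟩ := Monoid.fg_iff.1 (Group.fg_iff_monoid_fg.1 ‹Group.FG Kˣ›)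
  have : Algebra.FiniteType ℤ K := by
    refine ⟨(Subalgebra.fg_def).2 ⟨Units.val '' S, hfin.image _, eq_top_iff.2 fun x _ ↦ ?_⟩⟩
    by_cases hx : x = 0
    · exact hx ▸ zero_mem _
    · have hmem : Units.mk0 x hx ∈ Submonoid.closure S := hS ▸ Submonoid.mem_top _
      have := Submonoid.mem_map_of_mem (Units.coeHom K) hmem
      rw [MonoidHom.map_mclosure] at this
      exact Submonoid.closure_le (S := (Algebra.adjoin ℤ _).toSubmonoid) |>.2
        Algebra.subset_adjoin this
  -- Zariski's lemma. Were `ℤ → K` injective, integrality would make `ℤ` a field; so some `m ≠ 0`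
  -- kills `K`, a finitely generated torsion group.
  have : Module.Finite ℤ K := finite_of_finite_type_of_isJacobsonRing ℤ K
  have hinj : ¬ Function.Injective (algebraMap ℤ K) := fun hinj ↦
    Int.not_isField (isField_of_isIntegral_of_isField hinj (Field.toIsField K))
  obtain ⟨m, hm0, hm⟩ : ∃ m : ℤ, m ≠ 0 ∧ (m : K) = 0 := by
    rw [injective_iff_map_eq_zero] at hinj
    push Not at hinj
    obtain ⟨m, h1, h2⟩ := hinj
    exact ⟨m, h2, by simpa using h1⟩
  refine Module.finite_of_fg_torsion K fun {x} ↦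
    ⟨⟨m, mem_nonZeroDivisors_of_ne_zero hm0⟩, ?_⟩
  change m • x = 0
  rw [zsmul_eq_mul, hm, zero_mul]

namespace DivisionRing

variable {D : Type*} [DivisionRing D]

/-- The double centralizer of an element of a division ring is a field. -/
theorem isField_centralizer_centralizer (x : D) :
    IsField (Subring.centralizer (Set.centralizer {x} : Set D)) where
  exists_pair_ne := ⟨0, 1, zero_ne_one⟩
  mul_comm a b := Subtype.ext <| by
    -- Hence `a` commutes with `x`, so `a` lies in the centralizer of `x`, with which `b` commutes.
    have hx : x ∈ Set.centralizer ({x} : Set D) := by simp [Set.mem_centralizer_iff]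
    refine b.2 _ fun m hm ↦ ?_
    rw [Set.mem_singleton_iff.1 hm]
    exact a.2 x hx
  mul_inv_cancel {a} ha := by
    refine ⟨⟨(a : D)⁻¹, Set.inv_mem_centralizer₀ a.2⟩, Subtype.ext ?_⟩
    exact mul_inv_cancel₀ fun h ↦ ha (Subtype.ext h)

/-- The double centralizer of `u` is a field containing `u`, and its unit group embeds in `Dˣ`, so
it is finite. -/
theorem isOfFinOrder_of_isNoetherianGroup (h : IsNoetherianGroup Dˣ) (u : Dˣ) :
    IsOfFinOrder u := by
  let R := Subring.centralizer (Set.centralizer {(u : D)} : Set D)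
  let _ : Field R := (isField_centralizer_centralizer (u : D)).toField
  have hinj : Function.Injective R.subtype := Subtype.val_injective
  have hR : IsNoetherianGroup Rˣ :=
    h.of_injective (Units.map (R.subtype : R →* D)) (Units.map_injective hinj)
  have : Group.FG Rˣ := ⟨hR ⊤⟩
  have : Finite R := Field.finite_of_fg_units R
  have hu : (u : D) ∈ R := fun m hm ↦ (hm (u : D) rfl).symm
  have hu0 : (⟨u, hu⟩ : R) ≠ 0 := fun h0 ↦ u.ne_zero (congrArg Subtype.val h0)
  have hv := isOfFinOrder_of_finite (Units.mk0 (⟨u, hu⟩ : R) hu0)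
  have := (Units.map (R.subtype : R →* D)).isOfFinOrder hv
  rwa [show Units.map (R.subtype : R →* D) (Units.mk0 ⟨u, hu⟩ hu0) = u from Units.ext rfl]
    at this

end DivisionRing

theorem mainTheorem5 {D : Type*} [DivisionRing D] [Infinite D] (n : ℕ) (hn : 1 ≤ n) :
    ¬ IsPolycyclicByFinite (Matrix.GeneralLinearGroup (Fin n) D) := by
  intro h
  have : NeZero n := ⟨by omega⟩
  have hsc : Function.Injective (Matrix.scalar (Fin n) : D →+* Matrix (Fin n) (Fin n) D) :=
    RingHom.injective _
  let f : Dˣ →* Matrix.GeneralLinearGroup (Fin n) D :=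
    Units.map (Matrix.scalar (Fin n) : D →+* Matrix (Fin n) (Fin n) D)
  have hf : Function.Injective f := Units.map_injective hsc
  have ht :=
    DivisionRing.isOfFinOrder_of_isNoetherianGroup (h.isNoetherianGroup.of_injective f hf)
  have : Finite (⊤ : Subgroup Dˣ) :=
    h.hasFiniteTorsionSubgroups.of_injective f hf ⊤ fun g _ ↦ ht g
  have : Finite Dˣ := .of_injective _ Subgroup.topEquiv.symm.injective
  refine Set.infinite_univ (((Set.finite_range (Units.val : Dˣ → D)).insert 0).subset fun x _ ↦ ?_)
  exact (eq_or_ne x 0).imp id fun hx ↦ ⟨Units.mk0 x hx, rfl⟩
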